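/- For a finite undirected $d$-regular multigraph $\Gamma$ (loops and multiple edges allowed) with $n \ge 2$ vertices, let $1=\lambda_1\ge\lambda_2\ge\dots\ge\lambda_n\ge-1$ be the eigenvalues, with multiplicity, of its averaging operator $(\mathbf{M}v)(x)=\frac1d\sum_{y\sim x}v(y)$, and put $\lambda(\Gamma)=\max(|\lambda_2|,|\lambda_n|)$. If a group $G$ acts on a finite set $\Omega$ and $S$ is a finite symmetric multiset of elements of $G$, let $Sch(G\circlearrowleft\Omega,S)$ be the $|S|$-regular multigraph with vertex set $\Omega$ and one edge from $\omega$ to $\omega^s$ for each $\omega\in\Omega$ and each $s\in S$ (with multiplicity). A random multiset of $d$ elements of a finite group $G$ is $S=\{s_1,\dots,s_d\}$ with $s_1,\dots,s_d$ independent and uniformly distributed in $G$; $S\sqcup S^{-1}$ is the multiset $\{s_1,\dots,s_d,s_1^{-1},\dots,s_d^{-1}\}$. **Theorem.** (a) For every $\varepsilon>0$ there is a constant $C_\varepsilon>0$ such that, for every finite group $G$ and every transitive action of $G$ on a set $\Omega$ with $|\Omega|\ge2$, a random multiset $S$ of $\lceil C_\varepsilon\log|\Omega|\rceil$ elements of $G$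 satisfies $$\mathbb{E}\big[\lambda(Sch(G\circlearrowleft\Omega,S\sqcup S^{-1}))\big]\le\varepsilon .$$ (b) Let the finite group $G$ act transitively on $\Omega$ with $|\Omega|\ge2$, and let $\varepsilon,\delta>0$. For a random multiset $S$ of $\max\left(0,\left\lceil\frac{2}{\varepsilon^2}\ln\left(\frac{2|\Omega|}{\delta}\right)\right\rceil\right)$ elements of $G$ one has $$\mathrm{Prob}\big(\lambda(Sch(G\circlearrowleft\Omega,S\sqcup S^{-1}))\ge\varepsilon\big)\le\delta ,$$ where $\lambda$ is understood to be $0$ when $S$ is empty. -/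

import Mathlib

open scoped BigOperators

noncomputable section

/-- A multiset of group elements is symmetric if each element appears with the same multiplicity
as its inverse. -/
def SymmetricMultiset {G : Type*} [Group G] (S : Multiset G) : Prop :=
  S.map (fun s => s⁻¹) = S

/-- The multiset `S ⊔ S⁻¹` (multiplicities are added). -/
def symmetrization {G : Type*} [Group G] (S : Multiset G) : Multiset G :=
  S + S.map (fun s => s⁻¹)

theorem symmetrization_symmetric {G : Type*} [Group G] (S : Multiset G) :
    SymmetricMultiset (symmetrization S) := by
  simp [SymmetricMultiset, symmetrization, Multiset.map_map, add_comm]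

/-- The Schreier graph of the action of `G` on `Ω` with respect to `S`, as a multigraph (loops and
multiple edges allowed) given by its adjacency matrix: the number of edges from `x` to `y` is the
number of `s ∈ S`, counted with multiplicity, such that `s • x = y`. -/
def schreierAdj {G Ω : Type*} [Group G] [MulAction G Ω] [DecidableEq Ω] (S : Multiset G) :
    Matrix Ω Ω ℕ :=
  Matrix.of fun x y => S.countP (fun s => s • x = y)

/-- The averaging operator (random walk) of a `d`-regular multigraph with adjacency matrix `A`:
`(M v) x = (1 / d) * ∑ y, A x y * v y`. -/
def averagingMatrix {V : Type*} (A : Matrix V V ℕ) (d : ℕ) : Matrix V V ℝ :=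
  Matrix.of fun x y => (1 / (d : ℝ)) * (A x y : ℝ)

theorem schreierAdj_symm {G Ω : Type*} [Group G] [MulAction G Ω] [DecidableEq Ω]
    {S : Multiset G} (hS : SymmetricMultiset S) (x y : Ω) :
    schreierAdj S x y = schreierAdj S y x := by
  have h : (S.map (fun s => s⁻¹)).countP (fun s => s • x = y) =
      S.countP (fun s => s • y = x) := by
    rw [Multiset.countP_map, Multiset.countP_eq_card_filter]
    congr 1
    refine Multiset.filter_congr fun s _ => ?_
    rw [inv_smul_eq_iff, eq_comm]
  simp only [schreierAdj, Matrix.of_apply]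
  rw [← h, show S.map (fun s => s⁻¹) = S from hS]

theorem averagingMatrix_schreier_isHermitian {G Ω : Type*} [Group G] [MulAction G Ω]
    [DecidableEq Ω] {S : Multiset G} (hS : SymmetricMultiset S) :
    (averagingMatrix (schreierAdj S : Matrix Ω Ω ℕ) S.card).IsHermitian := by
  ext x y
  simp [averagingMatrix, schreierAdj_symm hS x y]

/-- For a real symmetric matrix with eigenvalues `λ₁ ≥ λ₂ ≥ ... ≥ λₙ` (listed with multiplicity),
`n ≥ 2`, the number `max (|λ₂|, |λₙ|)`. Note that `eigenvalues₀` is decreasing and is indexed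
from `0`. -/
def maxNontrivialEigenvalue {V : Type*} [Fintype V] [DecidableEq V] [Nontrivial V]
    {M : Matrix V V ℝ} (hM : M.IsHermitian) : ℝ :=
  max |hM.eigenvalues₀ ⟨1, Fintype.one_lt_card⟩|
    |hM.eigenvalues₀ ⟨Fintype.card V - 1, Nat.sub_lt Fintype.card_pos Nat.one_pos⟩|

/-- `λ(Sch(G ↻ Ω, S))` for a finite symmetric multiset `S` of elements of `G`. -/
def schreierLambda {G : Type*} [Group G] (Ω : Type*) [MulAction G Ω] [Fintype Ω] [DecidableEq Ω]
    [Nontrivial Ω] {S : Multiset G} (hS : SymmetricMultiset S) : ℝ :=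
  maxNontrivialEigenvalue (averagingMatrix_schreier_isHermitian (Ω := Ω) hS)

/-- `λ(Sch(G ↻ Ω, S ⊔ S⁻¹))` for the multiset `S = {s 0, ..., s (d - 1)}`. When `s` is a uniformly
random element of `Fin d → G`, this `S` is a random multiset of `d` elements, which are chosen
independently and uniformly from `G`. -/
def randomSchreierLambda {G : Type*} [Group G] (Ω : Type*) [MulAction G Ω] [Fintype Ω]
    [DecidableEq Ω] [Nontrivial Ω] {d : ℕ} (s : Fin d → G) : ℝ :=
  schreierLambda Ω (symmetrization_symmetric (Finset.univ.val.map s))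

/-- Expectation of a real function of `d` independent uniformly random elements of `G`. -/
def uniformExpectation {G : Type*} [Fintype G] {d : ℕ} (f : (Fin d → G) → ℝ) : ℝ :=
  (∑ s : Fin d → G, f s) / (Fintype.card (Fin d → G) : ℝ)

/-- Probability of an event depending on `d` independent uniformly random elements of `G`. -/
def uniformProbability {G : Type*} [Fintype G] {d : ℕ} (E : Set (Fin d → G)) : ℝ :=
  (E.ncard : ℝ) / (Fintype.card (Fin d → G) : ℝ)

end

/-! The theorem is a Hoeffding bound for random symmetric matrices, proved by exchangeable pairs.
Each `g` gives the matrix `centeredStep Ω g`: the average of the permutation operators of `g` and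
`g⁻¹`, minus the projection to constants. It is symmetric and a contraction, and by transitivity its
mean over `G` is zero. On vectors of sum zero, `Y = ∑ i, centeredStep Ω (s i)` is `d` times the
averaging operator of the Schreier graph. Since a nontrivial extremal eigenvalue has an eigenvector
of sum zero, `exp (t d λ) ≤ tr exp (tY) + tr exp (-tY)` for `t ≥ 0`.

It remains to bound `φ t = ∑ s, tr exp (tY)`. Its derivative is `∑ s, tr (Y exp (tY))`. Resampling
one coordinate of `s` turns each term of `Y` into half of `tr ((A - B) (f A - f B))`, where `A`, `B`
are the sums before and after and `f x = exp (t x)`. The mean value trace inequality replaces this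
by traces of `(A - B)²` against `f A + f B`, which mean zero and contractivity control. The result
is `φ' ≤ d t φ`, hence `φ t ≤ φ 0 * exp (d t² / 2)`. Jensen's inequality then gives (a), Markov's
gives (b). -/

/-! ### Spectral calculus and trace inequalities -/

open Matrix in
/-- The function `f` applied to a real symmetric matrix by means of its spectral decomposition. -/
noncomputable def Matrix.IsHermitian.spectralFun {V : Type*} [Fintype V] [DecidableEq V]
    {A : Matrix V V ℝ} (hA : A.IsHermitian) (f : ℝ → ℝ) : Matrix V V ℝ :=
  (hA.eigenvectorUnitary : Matrix V V ℝ) * diagonal (fun i => f (hA.eigenvalues i)) *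
    star (hA.eigenvectorUnitary : Matrix V V ℝ)

namespace Matrix.IsHermitian

variable {V : Type*} [Fintype V] [DecidableEq V] {A B : Matrix V V ℝ}

theorem spectralFun_id (hA : A.IsHermitian) : hA.spectralFun (fun x => x) = A := by
  conv_rhs => rw [hA.spectral_theorem, Unitary.conjStarAlgAut_apply]
  rfl

theorem spectralFun_one (hA : A.IsHermitian) : hA.spectralFun (fun _ => 1) = 1 := by
  simp [spectralFun]

theorem spectralFun_mul (hA : A.IsHermitian) (f g : ℝ → ℝ) :
    hA.spectralFun f * hA.spectralFun g = hA.spectralFun (fun x => f x * g x) := by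
  have h : star (hA.eigenvectorUnitary : Matrix V V ℝ) * (hA.eigenvectorUnitary : Matrix V V ℝ) = 1 :=
    Unitary.coe_star_mul_self _
  simp only [spectralFun]
  calc _ = (hA.eigenvectorUnitary : Matrix V V ℝ) * diagonal (fun i => f (hA.eigenvalues i)) *
        (star (hA.eigenvectorUnitary : Matrix V V ℝ) * (hA.eigenvectorUnitary : Matrix V V ℝ)) *
        diagonal (fun i => g (hA.eigenvalues i)) *
        star (hA.eigenvectorUnitary : Matrix V V ℝ) := by simp only [mul_assoc]
    _ = _ := by
      rw [h, mul_one, mul_assoc _ (diagonal _) (diagonal _), diagonal_mul_diagonal]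

/-- The overlaps of the eigenvectors of two symmetric matrices. -/
noncomputable def overlap (hA : A.IsHermitian) (hB : B.IsHermitian) : Matrix V V ℝ :=
  star (hA.eigenvectorUnitary : Matrix V V ℝ) * (hB.eigenvectorUnitary : Matrix V V ℝ)

/-- The weights `overlap ^ 2` are nonnegative and do not depend on `f` and `g`, so trace
inequalities between functions of two noncommuting matrices reduce to scalar inequalities at pairs
of eigenvalues. -/
theorem trace_spectralFun_mul_spectralFun (hA : A.IsHermitian) (hB : B.IsHermitian)
    (f g : ℝ → ℝ) :
    (hA.spectralFun f * hB.spectralFun g).trace =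
      ∑ i, ∑ j, f (hA.eigenvalues i) * g (hB.eigenvalues j) * overlap hA hB i j ^ 2 := by
  have h : (hA.spectralFun f * hB.spectralFun g).trace =
      ((diagonal (fun i => f (hA.eigenvalues i)) * overlap hA hB) *
        (diagonal (fun i => g (hB.eigenvalues i)) * star (overlap hA hB))).trace := by
    simp only [spectralFun, overlap, star_mul, star_star]
    rw [mul_assoc, mul_assoc, trace_mul_comm]
    simp only [mul_assoc]
  rw [h]
  simp only [trace, diag_apply, mul_apply (N := diagonal _ * _), diagonal_mul, star_apply,
    star_trivial]
  exact Finset.sum_congr rfl fun i _ => Finset.sum_congr rfl fun j _ => by ring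

theorem trace_spectralFun (hA : A.IsHermitian) (f : ℝ → ℝ) :
    (hA.spectralFun f).trace = ∑ i, f (hA.eigenvalues i) := by
  rw [spectralFun, trace_mul_comm, ← mul_assoc, Unitary.coe_star_mul_self, one_mul,
    trace_diagonal]

/-- The mean value trace inequality. -/
theorem trace_sub_mul_spectralFun_sub_le (hA : A.IsHermitian) (hB : B.IsHermitian)
    {f : ℝ → ℝ} {c : ℝ}
    (hf : ∀ x y, (x - y) * (f x - f y) ≤ c * ((x - y) ^ 2 * (f x + f y))) :
    ((A - B) * (hA.spectralFun f - hB.spectralFun f)).trace ≤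
      c * ((A - B) * (A - B) * (hA.spectralFun f + hB.spectralFun f)).trace := by
  have t := trace_spectralFun_mul_spectralFun hA hB
  have hl : ((A - B) * (hA.spectralFun f - hB.spectralFun f)).trace =
      ∑ i, ∑ j, (hA.eigenvalues i - hB.eigenvalues j) *
        (f (hA.eigenvalues i) - f (hB.eigenvalues j)) * overlap hA hB i j ^ 2 := by
    -- Every trace is brought to the form (function of `A`) times (function of `B`), inserting the
    -- constant function 1 for a missing factor.
    have e1 : (A * hA.spectralFun f).trace =
        (hA.spectralFun (fun x => x * f x) * hB.spectralFun (fun _ => 1)).trace := by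
      rw [spectralFun_one, mul_one, ← spectralFun_mul, spectralFun_id]
    have e2 : (A * hB.spectralFun f).trace =
        (hA.spectralFun (fun x => x) * hB.spectralFun f).trace := by rw [spectralFun_id]
    have e3 : (B * hA.spectralFun f).trace =
        (hA.spectralFun f * hB.spectralFun (fun x => x)).trace := by
      rw [spectralFun_id, trace_mul_comm]
    have e4 : (B * hB.spectralFun f).trace =
        (hA.spectralFun (fun _ => 1) * hB.spectralFun (fun x => x * f x)).trace := by
      rw [spectralFun_one, one_mul, ← spectralFun_mul, spectralFun_id]
    simp only [sub_mul, mul_sub, trace_sub]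
    rw [e1, e2, e3, e4, t, t, t, t]
    simp only [← Finset.sum_sub_distrib]
    exact Finset.sum_congr rfl fun i _ => Finset.sum_congr rfl fun j _ => by ring
  have hr : ((A - B) * (A - B) * (hA.spectralFun f + hB.spectralFun f)).trace =
      ∑ i, ∑ j, (hA.eigenvalues i - hB.eigenvalues j) ^ 2 *
        (f (hA.eigenvalues i) + f (hB.eigenvalues j)) * overlap hA hB i j ^ 2 := by
    have e1 : (A * A * hA.spectralFun f).trace =
        (hA.spectralFun (fun x => x * x * f x) * hB.spectralFun (fun _ => 1)).trace := by
      rw [spectralFun_one, mul_one, ← spectralFun_mul, ← spectralFun_mul, spectralFun_id]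
    have e2 : (A * B * hA.spectralFun f).trace =
        (hA.spectralFun (fun x => f x * x) * hB.spectralFun (fun x => x)).trace := by
      rw [← spectralFun_mul, spectralFun_id, spectralFun_id, trace_mul_comm, mul_assoc]
    have e3 : (B * A * hA.spectralFun f).trace =
        (hA.spectralFun (fun x => x * f x) * hB.spectralFun (fun x => x)).trace := by
      rw [← spectralFun_mul, spectralFun_id, spectralFun_id, mul_assoc, trace_mul_comm]
    have e4 : (B * B * hA.spectralFun f).trace =
        (hA.spectralFun f * hB.spectralFun (fun x => x * x)).trace := by
      rw [← spectralFun_mul, spectralFun_id, trace_mul_comm]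
    have e5 : (A * A * hB.spectralFun f).trace =
        (hA.spectralFun (fun x => x * x) * hB.spectralFun f).trace := by
      rw [← spectralFun_mul, spectralFun_id]
    have e6 : (A * B * hB.spectralFun f).trace =
        (hA.spectralFun (fun x => x) * hB.spectralFun (fun x => x * f x)).trace := by
      rw [← spectralFun_mul, spectralFun_id, spectralFun_id, mul_assoc]
    have e7 : (B * A * hB.spectralFun f).trace =
        (hA.spectralFun (fun x => x) * hB.spectralFun (fun x => f x * x)).trace := by
      rw [← spectralFun_mul, spectralFun_id, spectralFun_id, mul_assoc, trace_mul_comm, mul_assoc]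
    have e8 : (B * B * hB.spectralFun f).trace =
        (hA.spectralFun (fun _ => 1) * hB.spectralFun (fun x => x * x * f x)).trace := by
      rw [spectralFun_one, one_mul, ← spectralFun_mul, ← spectralFun_mul, spectralFun_id]
    simp only [sub_mul, mul_sub, mul_add, trace_sub, trace_add]
    rw [e1, e2, e3, e4, e5, e6, e7, e8, t, t, t, t, t, t, t, t]
    simp only [← Finset.sum_sub_distrib, ← Finset.sum_add_distrib]
    exact Finset.sum_congr rfl fun i _ => Finset.sum_congr rfl fun j _ => by ring
  rw [hl, hr, Finset.mul_sum]
  refine Finset.sum_le_sum fun i _ => ?_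
  rw [Finset.mul_sum]
  refine Finset.sum_le_sum fun j _ => ?_
  calc _ ≤ c * ((hA.eigenvalues i - hB.eigenvalues j) ^ 2 *
        (f (hA.eigenvalues i) + f (hB.eigenvalues j))) * overlap hA hB i j ^ 2 :=
        mul_le_mul_of_nonneg_right (hf _ _) (sq_nonneg _)
    _ = _ := by ring

/-- A symmetric contraction `X` satisfies `tr (X² f(A)) ≤ tr f(A)` for nonnegative `f`. -/
theorem trace_sq_mul_spectralFun_le (hA : A.IsHermitian) {X : Matrix V V ℝ} (hX : X.IsHermitian)
    (hc : ∀ v, (X *ᵥ v) ⬝ᵥ (X *ᵥ v) ≤ v ⬝ᵥ v) {f : ℝ → ℝ} (hf : ∀ x, 0 ≤ f x) :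
    (X * X * hA.spectralFun f).trace ≤ (hA.spectralFun f).trace := by
  have hu (i : V) : (hA.eigenvectorBasis i).ofLp ⬝ᵥ (hA.eigenvectorBasis i).ofLp = 1 := by
    have := hA.eigenvectorBasis.orthonormal.1 i
    rw [EuclideanSpace.norm_eq, Real.sqrt_eq_one] at this
    simpa [dotProduct, sq] using this
  have ht : (X * X * hA.spectralFun f).trace = ∑ i, f (hA.eigenvalues i) *
      ((X *ᵥ (hA.eigenvectorBasis i).ofLp) ⬝ᵥ (X *ᵥ (hA.eigenvectorBasis i).ofLp)) := by
    have hXs : star X = X := hX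
    set U : Matrix V V ℝ := (hA.eigenvectorUnitary : Matrix V V ℝ) with hU
    have : (X * X * hA.spectralFun f).trace =
        ((diagonal fun i => f (hA.eigenvalues i)) * (star (X * U) * (X * U))).trace := by
      rw [spectralFun, ← hU, star_mul, hXs, trace_mul_comm, mul_assoc, mul_assoc, trace_mul_comm]
      simp only [mul_assoc]
    rw [this]
    simp only [trace, diag_apply, diagonal_mul]
    refine Finset.sum_congr rfl fun i _ => ?_
    congr 1
  rw [ht, trace_spectralFun]
  refine Finset.sum_le_sum fun i _ => ?_
  exact mul_le_of_le_one_right (hf _) ((hc _).trans (hu i).le)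

/-- An eigenvalue of a symmetric matrix occurs among `eigenvalues`. -/
theorem exists_eigenvalues_eq (hA : A.IsHermitian) {v : V → ℝ} (hv : v ≠ 0) {r : ℝ}
    (h : A *ᵥ v = r • v) : ∃ i, hA.eigenvalues i = r := by
  have : Module.End.HasEigenvalue (Matrix.toLin' A) r :=
    Module.End.hasEigenvalue_of_hasEigenvector (x := v)
      ⟨Module.End.mem_eigenspace_iff.2 (by simpa using h), hv⟩
  have h2 := this.mem_spectrum
  rw [Matrix.spectrum_toLin', hA.spectrum_real_eq_range_eigenvalues] at h2
  exact h2

end Matrix.IsHermitian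

/-! ### Scalar inequalities for the exponential -/

/-- Equivalent to `tanh (x / 2) ≤ x / 2`; the difference of the two sides has derivative `exp x * (x
- 1) + 1`, nonnegative because `1 - x ≤ exp (-x)`. -/
theorem Real.two_mul_exp_sub_one_le {x : ℝ} (hx : 0 ≤ x) :
    2 * (Real.exp x - 1) ≤ x * (Real.exp x + 1) := by
  have hd (x : ℝ) : HasDerivAt (fun x => x * (Real.exp x + 1) - 2 * (Real.exp x - 1))
      (1 * (Real.exp x + 1) + x * Real.exp x - 2 * Real.exp x) x :=
    ((hasDerivAt_id' x).mul ((Real.hasDerivAt_exp x).add_const 1)).sub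
      (((Real.hasDerivAt_exp x).sub_const 1).const_mul 2)
  have hm : Monotone fun x : ℝ => x * (Real.exp x + 1) - 2 * (Real.exp x - 1) := by
    refine monotone_of_deriv_nonneg (fun x => (hd x).differentiableAt) fun x => ?_
    rw [(hd x).deriv]
    have h1 := Real.add_one_le_exp (-x)
    have h2 : Real.exp (-x) * Real.exp x = 1 := by rw [← Real.exp_add]; simp
    nlinarith [Real.exp_pos x]
  have := hm hx
  simp at this
  linarith

theorem Real.sub_mul_exp_sub_exp_le {t : ℝ} (ht : 0 ≤ t) (x y : ℝ) :
    (x - y) * (Real.exp (t * x) - Real.exp (t * y)) ≤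
      t / 2 * ((x - y) ^ 2 * (Real.exp (t * x) + Real.exp (t * y))) := by
  have main (x y : ℝ) (h : y ≤ x) : (x - y) * (Real.exp (t * x) - Real.exp (t * y)) ≤
      t / 2 * ((x - y) ^ 2 * (Real.exp (t * x) + Real.exp (t * y))) := by
    have h1 := Real.two_mul_exp_sub_one_le (mul_nonneg ht (sub_nonneg.2 h))
    have h2 : Real.exp (t * x) = Real.exp (t * (x - y)) * Real.exp (t * y) := by
      rw [← Real.exp_add]; ring_nf
    rw [h2]
    have := mul_le_mul_of_nonneg_left h1
      (mul_nonneg (sub_nonneg.2 h) (Real.exp_pos (t * y)).le)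
    nlinarith
  rcases le_total y x with h | h
  · exact main x y h
  · have := main y x h
    linarith

/-! ### Matrix Hoeffding bound by exchangeable pairs -/

section MatrixHoeffding

variable {G V ι : Type*}

theorem Matrix.isHermitian_sum_apply [Fintype ι] {X : G → Matrix V V ℝ}
    (hX : ∀ g, (X g).IsHermitian) (s : ι → G) : (∑ i, X (s i)).IsHermitian := by
  unfold Matrix.IsHermitian
  rw [Matrix.conjTranspose_sum]
  exact Finset.sum_congr rfl fun i _ => hX _

/-- Exchanging the coordinate `i` of a tuple with an external element. -/
def exchangeCoord [DecidableEq ι] (i : ι) : Equiv.Perm ((ι → G) × G) where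
  toFun p := (Function.update p.1 i p.2, p.1 i)
  invFun p := (Function.update p.1 i p.2, p.1 i)
  left_inv p := by simp
  right_inv p := by simp

theorem exchangeCoord_apply [DecidableEq ι] (i : ι) (p : (ι → G) × G) :
    exchangeCoord i p = (Function.update p.1 i p.2, p.1 i) := rfl

variable [Fintype G] [Fintype V] [Fintype ι] [DecidableEq V] [DecidableEq ι] {X : G → Matrix V V ℝ}

/-- Resample coordinate `i` by an independent `g`: the old and new tuples are exchangeable, so an
antisymmetric expression can be averaged with its swapped copy, which produces the difference of `f`
at the two sums. -/
theorem sum_trace_mul_spectralFun_le [Nonempty G] (hX : ∀ g, (X g).IsHermitian)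
    (h0 : ∑ g, X g = 0)
    (hc : ∀ g v, ((X g).mulVec v) ⬝ᵥ ((X g).mulVec v) ≤ v ⬝ᵥ v) {f : ℝ → ℝ} {t : ℝ} (ht : 0 ≤ t)
    (hf0 : ∀ x, 0 ≤ f x)
    (hf : ∀ x y, (x - y) * (f x - f y) ≤ t / 2 * ((x - y) ^ 2 * (f x + f y))) (i : ι) :
    ∑ s : ι → G, (X (s i) * (Matrix.isHermitian_sum_apply hX s).spectralFun f).trace ≤
      t * ∑ s : ι → G, ((Matrix.isHermitian_sum_apply hX s).spectralFun f).trace := by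
  set F : (ι → G) → Matrix V V ℝ := fun s => (Matrix.isHermitian_sum_apply hX s).spectralFun f
    with hF
  have hN : (0 : ℝ) < Fintype.card G := by exact_mod_cast Fintype.card_pos
  set T : ℝ := ∑ p : (ι → G) × G, ((X (p.1 i) - X p.2) * F p.1).trace with hT
  -- `F` does not see the fresh element `p.2`, whose matrix therefore averages to zero.
  have hT1 : T = Fintype.card G * ∑ s, (X (s i) * F s).trace := by
    rw [hT, Fintype.sum_prod_type, Finset.mul_sum]
    refine Finset.sum_congr rfl fun s _ => ?_
    simp only [sub_mul, Matrix.trace_sub, Finset.sum_sub_distrib, Finset.sum_const,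
      Finset.card_univ, nsmul_eq_mul]
    rw [← Matrix.trace_sum, ← Finset.sum_mul, h0]
    simp
  have hT2 : T = ∑ p : (ι → G) × G,
      ((X p.2 - X (p.1 i)) * F (Function.update p.1 i p.2)).trace := by
    rw [hT, ← Equiv.sum_comp (exchangeCoord i)]
    simp [exchangeCoord_apply]
  have hdiff (p : (ι → G) × G) :
      ∑ j, X (p.1 j) - ∑ j, X (Function.update p.1 i p.2 j) = X (p.1 i) - X p.2 := by
    rw [← Finset.sum_sub_distrib, Finset.sum_eq_single i]
    · simp
    · intro j _ hj
      simp [Function.update_of_ne hj]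
    · simp
  set Q : ℝ := ∑ p : (ι → G) × G,
    ((X (p.1 i) - X p.2) * (X (p.1 i) - X p.2) * F p.1).trace with hQ
  have hQ2 : Q = ∑ p : (ι → G) × G,
      ((X (p.1 i) - X p.2) * (X (p.1 i) - X p.2) * F (Function.update p.1 i p.2)).trace := by
    rw [hQ, ← Equiv.sum_comp (exchangeCoord i)]
    refine Finset.sum_congr rfl fun p _ => ?_
    simp only [exchangeCoord_apply, Function.update_self]
    rw [← neg_sub (X (p.1 i)), neg_mul_neg]
  have hTQ : 2 * T ≤ t * Q := by
    have h1 : 2 * T = ∑ p : (ι → G) × G,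
        ((X (p.1 i) - X p.2) * (F p.1 - F (Function.update p.1 i p.2))).trace := by
      rw [two_mul]
      nth_rewrite 2 [hT2]
      rw [hT, ← Finset.sum_add_distrib]
      refine Finset.sum_congr rfl fun p _ => ?_
      rw [← Matrix.trace_add]
      congr 1
      noncomm_ring
    have h2 : t * Q = ∑ p : (ι → G) × G, t / 2 * ((X (p.1 i) - X p.2) * (X (p.1 i) - X p.2) *
        (F p.1 + F (Function.update p.1 i p.2))).trace := by
      simp only [mul_add, Matrix.trace_add]
      rw [Finset.sum_add_distrib, ← Finset.mul_sum, ← Finset.mul_sum, ← hQ2, ← hQ]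
      ring
    rw [h1, h2]
    refine Finset.sum_le_sum fun p _ => ?_
    have := (Matrix.isHermitian_sum_apply hX p.1).trace_sub_mul_spectralFun_sub_le
      (Matrix.isHermitian_sum_apply hX (Function.update p.1 i p.2)) hf
    rwa [hdiff] at this
  have hQle : Q ≤ 2 * Fintype.card G * ∑ s, (F s).trace := by
    rw [hQ, Fintype.sum_prod_type, Finset.mul_sum]
    refine Finset.sum_le_sum fun s _ => ?_
    have hsq (g : G) : (X g * X g * F s).trace ≤ (F s).trace :=
      (Matrix.isHermitian_sum_apply hX s).trace_sq_mul_spectralFun_le (hX g) (hc g) hf0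
    have h1 : ∑ g, ((X (s i) - X g) * (X (s i) - X g) * F s).trace =
        ∑ g, ((X (s i) * X (s i) * F s).trace + (X g * X g * F s).trace) := by
      -- The cross terms are linear in `X g` and vanish after summation over `g`.
      have e : ∀ g, ((X (s i) - X g) * (X (s i) - X g) * F s).trace =
          (X (s i) * X (s i) * F s).trace + (X g * X g * F s).trace -
            ((X (s i) * X g * F s).trace + (X g * X (s i) * F s).trace) := by
        intro g
        rw [← Matrix.trace_add, ← Matrix.trace_add, ← Matrix.trace_sub]
        congr 1
        noncomm_ring
      simp only [e]
      rw [Finset.sum_sub_distrib, sub_eq_self, Finset.sum_add_distrib, ← Matrix.trace_sum,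
        ← Matrix.trace_sum, ← Finset.sum_mul, ← Finset.sum_mul, ← Finset.mul_sum,
        ← Finset.sum_mul, h0]
      simp
    rw [h1]
    calc _ ≤ ∑ _g : G, ((F s).trace + (F s).trace) :=
          Finset.sum_le_sum fun g _ => add_le_add (hsq _) (hsq g)
      _ = _ := by
        rw [Finset.sum_const, Finset.card_univ, nsmul_eq_mul]
        ring
  have : 2 * T ≤ 2 * Fintype.card G * (t * ∑ s, (F s).trace) :=
    hTQ.trans ((mul_le_mul_of_nonneg_left hQle ht).trans_eq (by ring))
  rw [hT1] at this
  have h3 : (2 * Fintype.card G : ℝ) * ∑ s, (X (s i) * F s).trace ≤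
      2 * Fintype.card G * (t * ∑ s, (F s).trace) := by linarith
  exact le_of_mul_le_mul_left h3 (by positivity)

/-- The exponential moment bound behind Hoeffding's inequality for random symmetric matrices. -/
theorem sum_sum_exp_eigenvalues_le [Nonempty G] (hX : ∀ g, (X g).IsHermitian)
    (h0 : ∑ g, X g = 0)
    (hc : ∀ g v, ((X g).mulVec v) ⬝ᵥ ((X g).mulVec v) ≤ v ⬝ᵥ v) {t : ℝ} (ht : 0 ≤ t) :
    ∑ s : ι → G, ∑ j, Real.exp (t * (Matrix.isHermitian_sum_apply hX s).eigenvalues j) ≤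
      Fintype.card (ι → G) * Fintype.card V * Real.exp (Fintype.card ι * t ^ 2 / 2) := by
  set e : (ι → G) → V → ℝ := fun s => (Matrix.isHermitian_sum_apply hX s).eigenvalues with he
  set φ : ℝ → ℝ := fun t => ∑ s : ι → G, ∑ j, Real.exp (t * e s j) with hφ
  have hφ' (t : ℝ) : HasDerivAt φ (∑ s : ι → G, ∑ j, e s j * Real.exp (t * e s j)) t := by
    refine HasDerivAt.fun_sum fun s _ => HasDerivAt.fun_sum fun j _ => ?_
    have := ((hasDerivAt_id' t).mul_const (e s j)).exp
    exact this.congr_deriv (by ring)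
  have hbound {t : ℝ} (ht : 0 ≤ t) :
      ∑ s : ι → G, ∑ j, e s j * Real.exp (t * e s j) ≤ Fintype.card ι * t * φ t := by
    have hsplit (s : ι → G) : ∑ j, e s j * Real.exp (t * e s j) =
        ∑ i, (X (s i) * (Matrix.isHermitian_sum_apply hX s).spectralFun
          fun x => Real.exp (t * x)).trace := by
      rw [← Matrix.trace_sum, ← Finset.sum_mul]
      conv_rhs =>
        enter [1, 1]
        rw [← (Matrix.isHermitian_sum_apply hX s).spectralFun_id]
      rw [Matrix.IsHermitian.spectralFun_mul, Matrix.IsHermitian.trace_spectralFun]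
    simp only [hsplit]
    rw [Finset.sum_comm]
    calc _ ≤ ∑ _i : ι, t * φ t := by
          refine Finset.sum_le_sum fun i _ => ?_
          refine (sum_trace_mul_spectralFun_le hX h0 hc ht (fun x => (Real.exp_pos _).le)
            (Real.sub_mul_exp_sub_exp_le ht) i).trans_eq ?_
          simp only [Matrix.IsHermitian.trace_spectralFun, hφ, he]
      _ = _ := by
        rw [Finset.sum_const, Finset.card_univ, nsmul_eq_mul]
        ring
  -- Grönwall's argument: the integrating factor turns `φ' ≤ d t φ` into monotonicity.
  have hψ (t : ℝ) : HasDerivAt (fun t => φ t * Real.exp (-(Fintype.card ι * t ^ 2 / 2)))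
      ((∑ s : ι → G, ∑ j, e s j * Real.exp (t * e s j)) *
        Real.exp (-(Fintype.card ι * t ^ 2 / 2)) +
        φ t * (Real.exp (-(Fintype.card ι * t ^ 2 / 2)) * (-(Fintype.card ι * t)))) t := by
    refine (hφ' t).mul (HasDerivAt.exp ?_)
    have := (((hasDerivAt_pow 2 t).const_mul (Fintype.card ι : ℝ)).div_const 2).neg
    refine this.congr_deriv ?_
    push_cast
    ring
  have hanti : AntitoneOn (fun t => φ t * Real.exp (-(Fintype.card ι * t ^ 2 / 2)))
      (Set.Ici 0) := by
    refine antitoneOn_of_deriv_nonpos (convex_Ici 0)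
      (fun t _ => (hψ t).continuousAt.continuousWithinAt)
      (fun t _ => (hψ t).differentiableAt.differentiableWithinAt) fun t h => ?_
    rw [interior_Ici] at h
    rw [(hψ t).deriv]
    have := mul_le_mul_of_nonneg_right (hbound (le_of_lt h))
      (Real.exp_pos (-(Fintype.card ι * t ^ 2 / 2))).le
    linarith
  have h1 := hanti (Set.mem_Ici.2 le_rfl) ht ht
  have h2 : φ 0 = Fintype.card (ι → G) * Fintype.card V := by
    simp [hφ]
  simp only [h2] at h1
  rw [Real.exp_neg, ← div_eq_mul_inv, div_le_iff₀ (Real.exp_pos _)] at h1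
  simpa using h1

end MatrixHoeffding

/-! ### Nontrivial eigenvalues and vectors of sum zero -/

section NontrivialEigenvalue

open Matrix

variable {V : Type*} [Fintype V] {M : Matrix V V ℝ}

theorem Matrix.IsHermitian.sum_eq_zero_of_eigenvector (hM : M.IsHermitian)
    (h1 : M *ᵥ (fun _ => 1) = fun _ => 1) {v : V → ℝ} {r : ℝ} (hv : M *ᵥ v = r • v)
    (hr : r ≠ 1) : ∑ x, v x = 0 := by
  have h : (fun _ => (1 : ℝ)) ⬝ᵥ (M *ᵥ v) = (fun _ => (1 : ℝ)) ⬝ᵥ v := by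
    have hT : Mᵀ = M := by simpa [Matrix.IsHermitian] using hM
    rw [dotProduct_mulVec, ← mulVec_transpose, hT, h1]
  rw [hv, dotProduct_smul, smul_eq_mul] at h
  have h2 : (r - 1) * ((fun _ => (1 : ℝ)) ⬝ᵥ v) = 0 := by linarith
  simpa [dotProduct] using (mul_eq_zero.1 h2).resolve_left (sub_ne_zero.2 hr)

/-- If the constant functions are fixed by `M`, the largest nontrivial eigenvalue is attained at an
eigenvector with vanishing sum. -/
theorem exists_eigenvector_maxNontrivialEigenvalue_le [DecidableEq V] [Nontrivial V] (hM : M.IsHermitian)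
    (h1 : M *ᵥ (fun _ => 1) = fun _ => 1) :
    ∃ (v : V → ℝ) (r : ℝ), v ≠ 0 ∧ ∑ x, v x = 0 ∧ M *ᵥ v = r • v ∧
      maxNontrivialEigenvalue hM ≤ |r| := by
  set q : Fin (Fintype.card V) ≃ V := Fintype.equivOfCardEq (Fintype.card_fin _) with hq
  set a := hM.eigenvalues₀ with ha
  set b : Fin (Fintype.card V) → V → ℝ := fun k => (hM.eigenvectorBasis (q k)).ofLp with hb
  have hab (k) : M *ᵥ b k = a k • b k := by
    have := hM.mulVec_eigenvectorBasis (q k)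
    rwa [Matrix.IsHermitian.eigenvalues, Equiv.symm_apply_apply] at this
  have hb0 (k) : b k ≠ 0 := fun h =>
    hM.eigenvectorBasis.orthonormal.ne_zero (q k) (WithLp.ofLp_injective 2 h)
  have hs (k) (hk : a k ≠ 1) : ∑ x, b k x = 0 := hM.sum_eq_zero_of_eigenvector h1 (hab k) hk
  set k0 : Fin (Fintype.card V) := ⟨0, Fintype.card_pos⟩
  set k1 : Fin (Fintype.card V) := ⟨1, Fintype.one_lt_card⟩ with hk1
  set kl : Fin (Fintype.card V) :=
    ⟨Fintype.card V - 1, Nat.sub_lt Fintype.card_pos Nat.one_pos⟩ with hkl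
  have h01 : a k1 ≤ a k0 := hM.eigenvalues₀_antitone (Fin.mk_le_mk.2 zero_le_one)
  have h1l : a kl ≤ a k1 := hM.eigenvalues₀_antitone
    (Fin.mk_le_mk.2 (Nat.le_sub_one_of_lt Fintype.one_lt_card))
  have second : ∃ (v : V → ℝ) (r : ℝ), v ≠ 0 ∧ ∑ x, v x = 0 ∧ M *ᵥ v = r • v ∧ |a k1| ≤ |r| := by
    -- If the second eigenvalue is 1, its eigenvector need not have sum zero. No bound of the
    -- spectrum by 1 is used: `1 ≤ a k0` suffices.
    by_cases hk : a k1 = 1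
    · by_cases hz : ∑ x, b k0 x = 0
      · refine ⟨b k0, a k0, hb0 _, hz, hab _, ?_⟩
        rw [hk, abs_one]
        exact (hk ▸ h01).trans (le_abs_self _)
      · have hk0 : a k0 = 1 := not_not.1 fun h => hz (hs k0 h)
        -- In a two-dimensional space of fixed vectors some nonzero combination has sum zero.
        refine ⟨(∑ x, b k0 x) • b k1 - (∑ x, b k1 x) • b k0, 1, fun h => ?_, ?_, ?_, by simp [hk]⟩
        · have hne : q k1 ≠ q k0 := fun h => by
            have := q.injective h
            simp [k1, k0] at this
          have hon := hM.eigenvectorBasis.orthonormal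
          have h' : (∑ x, b k0 x) • hM.eigenvectorBasis (q k1) -
              (∑ x, b k1 x) • hM.eigenvectorBasis (q k0) = 0 := WithLp.ofLp_injective 2 h
          have h2 := congrArg (inner ℝ (hM.eigenvectorBasis (q k1))) h'
          rw [inner_sub_right, inner_smul_right, inner_smul_right, hon.2 hne,
            real_inner_self_eq_norm_sq, hon.1, inner_zero_right] at h2
          exact hz (by simpa using h2)
        · simp only [Pi.sub_apply, Pi.smul_apply, smul_eq_mul, Finset.sum_sub_distrib,
            ← Finset.mul_sum]
          ring
        · rw [mulVec_sub, mulVec_smul, mulVec_smul, hab, hab, hk, hk0, one_smul, one_smul, one_smul]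
    · exact ⟨b k1, a k1, hb0 _, hs _ hk, hab _, le_rfl⟩
  rcases le_total |a kl| |a k1| with h | h
  · obtain ⟨v, r, h2, h3, h4, h5⟩ := second
    exact ⟨v, r, h2, h3, h4, max_le h5 (h.trans h5)⟩
  · by_cases hk : a kl = 1
    · obtain ⟨v, r, h2, h3, h4, h5⟩ := second
      refine ⟨v, r, h2, h3, h4, max_le h5 (le_trans ?_ h5)⟩
      change |a kl| ≤ |a k1|
      rw [hk, abs_one]
      exact (hk ▸ h1l).trans (le_abs_self _)
    · exact ⟨b kl, a kl, hb0 _, hs _ hk, hab _, max_le h le_rfl⟩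

end NontrivialEigenvalue

/-! ### Centered steps of the Schreier graph -/

section SchreierStep

open Matrix

variable {G : Type*} [Group G] (Ω : Type*) [MulAction G Ω] [Fintype Ω] [DecidableEq Ω]

/-- The averaging operator of `{g, g⁻¹}` minus the projection to the constant functions. -/
noncomputable def centeredStep (g : G) : Matrix Ω Ω ℝ :=
  Matrix.of fun x y => ((if g • x = y then 1 else 0) + (if g⁻¹ • x = y then 1 else 0)) / 2 -
    1 / (Fintype.card Ω : ℝ)

theorem centeredStep_isHermitian (g : G) : (centeredStep Ω g).IsHermitian := by
  ext x y
  have h1 : g • y = x ↔ g⁻¹ • x = y := by rw [inv_smul_eq_iff, eq_comm]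
  have h2 : g⁻¹ • y = x ↔ g • x = y := by rw [inv_smul_eq_iff, eq_comm]
  simp only [centeredStep, conjTranspose_apply, of_apply, star_trivial, h1, h2]
  ring

theorem centeredStep_mulVec (g : G) (v : Ω → ℝ) (x : Ω) :
    (centeredStep Ω g *ᵥ v) x =
      (v (g • x) + v (g⁻¹ • x)) / 2 - (∑ y, v y) / Fintype.card Ω := by
  simp only [mulVec, dotProduct, centeredStep, of_apply]
  have : ∀ y, (((if g • x = y then (1 : ℝ) else 0) + (if g⁻¹ • x = y then 1 else 0)) / 2 -
      1 / (Fintype.card Ω : ℝ)) * v y = ((if g • x = y then v y else 0) +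
        (if g⁻¹ • x = y then v y else 0)) / 2 - v y / Fintype.card Ω := by
    intro y
    split_ifs <;> ring
  simp only [this]
  rw [Finset.sum_sub_distrib, ← Finset.sum_div, ← Finset.sum_div, Finset.sum_add_distrib]
  simp

theorem centeredStep_mulVec_dotProduct_le (g : G) (v : Ω → ℝ) :
    (centeredStep Ω g *ᵥ v) ⬝ᵥ (centeredStep Ω g *ᵥ v) ≤ v ⬝ᵥ v := by
  rcases isEmpty_or_nonempty Ω with h | h
  · simp [dotProduct]
  have hn : (Fintype.card Ω : ℝ) ≠ 0 := by exact_mod_cast Fintype.card_ne_zero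
  set m := (∑ y, v y) / Fintype.card Ω with hm
  have hs : ∑ y, v y = Fintype.card Ω * m := by rw [hm]; field_simp
  have e (g : G) : ∑ x, (v (g • x) - m) ^ 2 = ∑ x, (v x - m) ^ 2 :=
    Equiv.sum_comp (MulAction.toPerm g) fun x => (v x - m) ^ 2
  -- Permutations preserve the mean `m`; convexity of the square bounds the sum by the variance,
  -- which is at most the second moment.
  calc _ = ∑ x, ((v (g • x) + v (g⁻¹ • x)) / 2 - m) ^ 2 := by
        simp only [dotProduct, centeredStep_mulVec, ← hm, sq]
    _ ≤ ∑ x, ((v (g • x) - m) ^ 2 + (v (g⁻¹ • x) - m) ^ 2) / 2 := by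
        refine Finset.sum_le_sum fun x _ => ?_
        nlinarith [sq_nonneg (v (g • x) - v (g⁻¹ • x))]
    _ = ∑ x, (v x - m) ^ 2 := by
        rw [← Finset.sum_div, Finset.sum_add_distrib, e, e]
        ring
    _ = ∑ x, v x ^ 2 - Fintype.card Ω * m ^ 2 := by
        have : ∀ x, (v x - m) ^ 2 = v x ^ 2 - 2 * m * v x + m ^ 2 := fun x => by ring
        simp only [this]
        rw [Finset.sum_add_distrib, Finset.sum_sub_distrib, ← Finset.mul_sum, hs]
        simp
        ring
    _ ≤ ∑ x, v x ^ 2 := sub_le_self _ (by positivity)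
    _ = _ := by simp only [dotProduct, sq]

/-- By transitivity, left translation in `G` shows that every target is hit equally often. -/
theorem card_mul_sum_ite_smul_eq [Fintype G] [MulAction.IsPretransitive G Ω] (x y : Ω) :
    (Fintype.card Ω : ℝ) * ∑ g : G, (if g • x = y then (1 : ℝ) else 0) = Fintype.card G := by
  have h (z : Ω) : ∑ g : G, (if g • x = z then (1 : ℝ) else 0) =
      ∑ g : G, (if g • x = y then (1 : ℝ) else 0) := by
    obtain ⟨h, rfl⟩ := MulAction.exists_smul_eq G y z
    rw [← Equiv.sum_comp (Equiv.mulLeft h)]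
    simp [mul_smul]
  calc _ = ∑ z : Ω, ∑ g : G, (if g • x = z then (1 : ℝ) else 0) := by
        simp only [h, Finset.sum_const, Finset.card_univ, nsmul_eq_mul]
    _ = _ := by
        rw [Finset.sum_comm]
        simp

theorem sum_centeredStep [Fintype G] [MulAction.IsPretransitive G Ω] :
    ∑ g : G, centeredStep Ω g = 0 := by
  ext x y
  have hn : (Fintype.card Ω : ℝ) ≠ 0 := by
    have : Nonempty Ω := ⟨x⟩
    exact_mod_cast Fintype.card_ne_zero
  have h := card_mul_sum_ite_smul_eq (G := G) Ω x y
  have h' : ∑ g : G, (if g⁻¹ • x = y then (1 : ℝ) else 0) =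
      ∑ g : G, (if g • x = y then (1 : ℝ) else 0) :=
    Equiv.sum_comp (Equiv.inv G) fun g => if g • x = y then (1 : ℝ) else 0
  simp only [Matrix.sum_apply, centeredStep, of_apply, Matrix.zero_apply]
  rw [Finset.sum_sub_distrib, ← Finset.sum_div, Finset.sum_add_distrib, h']
  simp only [Finset.sum_const, Finset.card_univ, nsmul_eq_mul]
  rw [← h]
  field_simp
  ring

theorem card_symmetrization_map {d : ℕ} (s : Fin d → G) :
    (symmetrization (Finset.univ.val.map s)).card = d + d := by
  simp [symmetrization]

theorem sum_centeredStep_apply {d : ℕ} (hd : 0 < d) (s : Fin d → G) (x y : Ω) :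
    (∑ i, centeredStep Ω (s i)) x y =
      d * (averagingMatrix (schreierAdj (symmetrization (Finset.univ.val.map s)))
        (symmetrization (Finset.univ.val.map s)).card : Matrix Ω Ω ℝ) x y -
        d / Fintype.card Ω := by
  have hd' : (d : ℝ) ≠ 0 := by exact_mod_cast hd.ne'
  have hA : ((schreierAdj (symmetrization (Finset.univ.val.map s)) x y : ℕ) : ℝ) =
      ∑ i, ((if s i • x = y then 1 else 0) + (if (s i)⁻¹ • x = y then (1 : ℝ) else 0)) := by
    simp only [schreierAdj, of_apply, symmetrization, Multiset.countP_add, Multiset.map_map,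
      Multiset.countP_map, Nat.cast_add, Finset.sum_add_distrib, Finset.sum_boole]
    rfl
  simp only [averagingMatrix, of_apply]
  rw [hA, card_symmetrization_map]
  simp only [Matrix.sum_apply, centeredStep, of_apply]
  rw [Finset.sum_sub_distrib, ← Finset.sum_div]
  simp only [Finset.sum_const, Finset.card_univ, nsmul_eq_mul, Fintype.card_fin]
  push_cast
  field_simp
  ring

theorem sum_centeredStep_mulVec {d : ℕ} (hd : 0 < d) (s : Fin d → G) (v : Ω → ℝ) (x : Ω) :
    ((∑ i, centeredStep Ω (s i)) *ᵥ v) x =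
      d * ((averagingMatrix (schreierAdj (symmetrization (Finset.univ.val.map s)))
        (symmetrization (Finset.univ.val.map s)).card : Matrix Ω Ω ℝ) *ᵥ v) x -
        d / Fintype.card Ω * ∑ y, v y := by
  simp only [mulVec, dotProduct, sum_centeredStep_apply Ω hd]
  rw [Finset.mul_sum, Finset.mul_sum, ← Finset.sum_sub_distrib]
  exact Finset.sum_congr rfl fun y _ => by ring

theorem averagingMatrix_schreierAdj_mulVec_one {d : ℕ} (hd : 0 < d) (s : Fin d → G) :
    (averagingMatrix (schreierAdj (symmetrization (Finset.univ.val.map s)))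
      (symmetrization (Finset.univ.val.map s)).card : Matrix Ω Ω ℝ) *ᵥ (fun _ => 1) =
      fun _ => 1 := by
  ext x
  have hn : (Fintype.card Ω : ℝ) ≠ 0 := by
    have : Nonempty Ω := ⟨x⟩
    exact_mod_cast Fintype.card_ne_zero
  have hd' : (d : ℝ) ≠ 0 := by exact_mod_cast hd.ne'
  have h := sum_centeredStep_mulVec Ω hd s (fun _ => 1) x
  rw [sum_mulVec, Finset.sum_apply] at h
  simp only [centeredStep_mulVec, Finset.sum_const, Finset.card_univ, nsmul_eq_mul, mul_one,
    div_mul_cancel₀ _ hn, div_self hn, add_self_div_two, sub_self, mul_zero] at h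
  have h2 : (d : ℝ) * (((averagingMatrix (schreierAdj (symmetrization (Finset.univ.val.map s)))
      (symmetrization (Finset.univ.val.map s)).card : Matrix Ω Ω ℝ) *ᵥ (fun _ => 1)) x - 1) = 0 := by
    linarith
  exact sub_eq_zero.1 ((mul_eq_zero.1 h2).resolve_left hd')

/-- The sum-zero eigenvector for `r` has eigenvalue `d * r` under the sum of centered steps; both
signs are needed because λ is an absolute value. -/
theorem exp_randomSchreierLambda_le [Nontrivial Ω] {d : ℕ} (hd : 0 < d) (s : Fin d → G) {t : ℝ}
    (ht : 0 ≤ t) :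
    Real.exp (t * (d * randomSchreierLambda Ω s)) ≤
      ∑ j, Real.exp (t * (isHermitian_sum_apply (centeredStep_isHermitian Ω) s).eigenvalues j) +
      ∑ j, Real.exp (t * (isHermitian_sum_apply (X := fun g => -centeredStep Ω g)
        (fun g => (centeredStep_isHermitian Ω g).neg) s).eigenvalues j) := by
  obtain ⟨v, r, hv, hs, hr, hle⟩ := exists_eigenvector_maxNontrivialEigenvalue_le
    (averagingMatrix_schreier_isHermitian (Ω := Ω)
      (symmetrization_symmetric (Finset.univ.val.map s)))
    (averagingMatrix_schreierAdj_mulVec_one Ω hd s)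
  have hY : (∑ i, centeredStep Ω (s i)) *ᵥ v = (d * r) • v := by
    ext x
    rw [sum_centeredStep_mulVec Ω hd, hs, hr]
    simp [mul_assoc]
  have hY' : (∑ i, -centeredStep Ω (s i)) *ᵥ v = (-(d * r)) • v := by
    rw [Finset.sum_neg_distrib, neg_mulVec, hY, neg_smul]
  obtain ⟨i, hi⟩ := (isHermitian_sum_apply (centeredStep_isHermitian Ω) s).exists_eigenvalues_eq
    hv hY
  obtain ⟨j, hj⟩ := (isHermitian_sum_apply (X := fun g => -centeredStep Ω g)
    (fun g => (centeredStep_isHermitian Ω g).neg) s).exists_eigenvalues_eq hv hY'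
  have h1 := Finset.single_le_sum (f := fun j => Real.exp (t *
    (isHermitian_sum_apply (centeredStep_isHermitian Ω) s).eigenvalues j))
    (fun _ _ => (Real.exp_pos _).le) (Finset.mem_univ i)
  have h2 := Finset.single_le_sum (f := fun j => Real.exp (t *
    (isHermitian_sum_apply (X := fun g => -centeredStep Ω g)
      (fun g => (centeredStep_isHermitian Ω g).neg) s).eigenvalues j))
    (fun _ _ => (Real.exp_pos _).le) (Finset.mem_univ j)
  simp only [hi] at h1
  simp only [hj] at h2
  have h3 : Real.exp (t * (d * randomSchreierLambda Ω s)) ≤ Real.exp (t * (d * |r|)) := by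
    gcongr
    exact hle
  refine h3.trans ?_
  rcases abs_cases r with ⟨h, _⟩ | ⟨h, _⟩
  · rw [h]
    exact h1.trans (le_add_of_nonneg_right (Finset.sum_nonneg fun _ _ => (Real.exp_pos _).le))
  · rw [h, mul_neg]
    exact h2.trans (le_add_of_nonneg_left (Finset.sum_nonneg fun _ _ => (Real.exp_pos _).le))

theorem sum_exp_randomSchreierLambda_le [Fintype G] [MulAction.IsPretransitive G Ω] [Nontrivial Ω]
    {d : ℕ} (hd : 0 < d) {t : ℝ} (ht : 0 ≤ t) :
    ∑ s : Fin d → G, Real.exp (t * (d * randomSchreierLambda Ω s)) ≤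
      Fintype.card (Fin d → G) * (2 * Fintype.card Ω * Real.exp (d * t ^ 2 / 2)) := by
  have h1 := sum_sum_exp_eigenvalues_le (ι := Fin d) (centeredStep_isHermitian (G := G) Ω)
    (sum_centeredStep Ω) (centeredStep_mulVec_dotProduct_le Ω) ht
  have h2 := sum_sum_exp_eigenvalues_le (ι := Fin d) (X := fun g : G => -centeredStep Ω g)
    (fun g => (centeredStep_isHermitian Ω g).neg)
    (by rw [Finset.sum_neg_distrib, sum_centeredStep, neg_zero])
    (fun g v => by
      rw [neg_mulVec, neg_dotProduct_neg]
      exact centeredStep_mulVec_dotProduct_le Ω g v) ht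
  refine (Finset.sum_le_sum fun s _ => exp_randomSchreierLambda_le Ω hd s ht).trans ?_
  rw [Finset.sum_add_distrib]
  refine (add_le_add h1 h2).trans_eq ?_
  rw [Fintype.card_fin (n := d)]
  ring

end SchreierStep

/-! ### Expectation and tail bounds -/

theorem uniformExpectation_randomSchreierLambda_le {G Ω : Type*} [Group G] [Fintype G] [Fintype Ω]
    [DecidableEq Ω] [Nontrivial Ω] [MulAction G Ω] [MulAction.IsPretransitive G Ω]
    {d : ℕ} (hd : 0 < d) {t : ℝ} (ht : 0 < t) :
    uniformExpectation (fun s : Fin d → G => randomSchreierLambda Ω s) ≤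
      Real.log (2 * Fintype.card Ω) / (t * d) + t / 2 := by
  set K : ℝ := 2 * Fintype.card Ω * Real.exp (d * t ^ 2 / 2) with hK
  have hn : (0 : ℝ) < Fintype.card Ω := by exact_mod_cast Fintype.card_pos
  have hN : (0 : ℝ) < Fintype.card (Fin d → G) := by exact_mod_cast Fintype.card_pos
  have hd' : (0 : ℝ) < d := by exact_mod_cast hd
  have hKpos : 0 < K := by positivity
  have hlog : Real.log K = Real.log (2 * Fintype.card Ω) + d * t ^ 2 / 2 := by
    rw [hK, Real.log_mul (by positivity) (Real.exp_pos _).ne', Real.log_exp]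
  -- Jensen's inequality by the tangent line of `exp` at `log K`, where `K` bounds the mean
  -- exponential.
  have hpt (s : Fin d → G) : t * d * randomSchreierLambda Ω s ≤
      Real.log K - 1 + Real.exp (t * (d * randomSchreierLambda Ω s)) / K := by
    have := Real.add_one_le_exp (t * (d * randomSchreierLambda Ω s) - Real.log K)
    rw [Real.exp_sub, Real.exp_log hKpos] at this
    linarith
  have hsum := Finset.sum_le_sum fun s (_ : s ∈ (Finset.univ : Finset (Fin d → G))) => hpt s
  rw [← Finset.mul_sum, Finset.sum_add_distrib, ← Finset.sum_div, Finset.sum_const,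
    Finset.card_univ, nsmul_eq_mul] at hsum
  have h2 := (div_le_iff₀ hKpos).2 (sum_exp_randomSchreierLambda_le (G := G) Ω hd ht.le)
  rw [uniformExpectation, div_le_iff₀ hN]
  have h3 : t * d * ∑ s : Fin d → G, randomSchreierLambda Ω s ≤
      Fintype.card (Fin d → G) * Real.log K := by linarith
  rw [hlog] at h3
  refine le_of_mul_le_mul_left (h3.trans_eq ?_) (mul_pos ht hd')
  field_simp

theorem uniformProbability_le_randomSchreierLambda_le {G Ω : Type*} [Group G] [Fintype G]
    [Fintype Ω] [DecidableEq Ω] [Nontrivial Ω] [MulAction G Ω] [MulAction.IsPretransitive G Ω]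
    {d : ℕ} (hd : 0 < d) {ε : ℝ} (hε : 0 ≤ ε) :
    uniformProbability {s : Fin d → G | ε ≤ randomSchreierLambda Ω s} ≤
      2 * Fintype.card Ω * Real.exp (-(d * ε ^ 2 / 2)) := by
  classical
  have hN : (0 : ℝ) < Fintype.card (Fin d → G) := by exact_mod_cast Fintype.card_pos
  rw [uniformProbability, div_le_iff₀ hN, Set.ncard_eq_toFinset_card', Set.toFinset_ofPred]
  -- Markov's inequality at `t = ε`, which minimizes `d t² / 2 - t d ε`.
  have h1 : ((Finset.univ.filter fun s : Fin d → G => ε ≤ randomSchreierLambda Ω s).card : ℝ) *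
      Real.exp (ε * (d * ε)) ≤
      Fintype.card (Fin d → G) * (2 * Fintype.card Ω * Real.exp (d * ε ^ 2 / 2)) := by
    refine le_trans ?_ (sum_exp_randomSchreierLambda_le (G := G) Ω hd hε)
    refine le_trans ?_ (Finset.sum_le_sum_of_subset_of_nonneg (Finset.filter_subset
      (fun s : Fin d → G => ε ≤ randomSchreierLambda Ω s) _) fun _ _ _ => (Real.exp_pos _).le)
    rw [← nsmul_eq_mul]
    refine Finset.card_nsmul_le_sum _ _ _ fun s hs => ?_
    have := (Finset.mem_filter.1 hs).2
    gcongr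
  rw [← le_div_iff₀ (Real.exp_pos _)] at h1
  refine h1.trans_eq ?_
  rw [div_eq_mul_inv, ← Real.exp_neg, mul_assoc, mul_assoc, ← Real.exp_add, mul_comm]
  congr 3
  ring

/-- With `1 / 0 = 0` the averaging matrix is zero, matching the convention for empty `S`. -/
theorem randomSchreierLambda_of_isEmpty {G Ω : Type*} [Group G] [Fintype Ω]
    [DecidableEq Ω] [Nontrivial Ω] [MulAction G Ω] (s : Fin 0 → G) :
    randomSchreierLambda Ω s = 0 := by
  have h0 : (averagingMatrix (schreierAdj (symmetrization (Finset.univ.val.map s)))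
      (symmetrization (Finset.univ.val.map s)).card : Matrix Ω Ω ℝ) = 0 := by
    ext x y
    rw [card_symmetrization_map]
    simp [averagingMatrix]
  have hM := averagingMatrix_schreier_isHermitian (Ω := Ω)
    (symmetrization_symmetric (Finset.univ.val.map s))
  have he : hM.eigenvalues = 0 := hM.eigenvalues_eq_zero_iff.2 h0
  have he₀ (k) : hM.eigenvalues₀ k = 0 := by
    have := congrFun he (Fintype.equivOfCardEq (Fintype.card_fin _) k)
    rwa [Matrix.IsHermitian.eigenvalues, Equiv.symm_apply_apply] at this
  rw [randomSchreierLambda, schreierLambda, maxNontrivialEigenvalue, he₀, he₀, abs_zero, max_self]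

theorem theorem1 :
    (∀ ε : ℝ, 0 < ε → ∃ C : ℝ, 0 < C ∧
      ∀ (G : Type*) (Ω : Type*) [Group G] [Fintype G] [Fintype Ω] [DecidableEq Ω] [Nontrivial Ω]
        [MulAction G Ω] [MulAction.IsPretransitive G Ω],
        uniformExpectation
          (fun s : Fin ⌈C * Real.log (Fintype.card Ω)⌉₊ → G => randomSchreierLambda Ω s) ≤ ε) ∧
    (∀ (G : Type*) (Ω : Type*) [Group G] [Fintype G] [Fintype Ω] [DecidableEq Ω] [Nontrivial Ω]
      [MulAction G Ω] [MulAction.IsPretransitive G Ω] (ε δ : ℝ), 0 < ε → 0 < δ →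
        uniformProbability
          {s : Fin ⌈2 / ε ^ 2 * Real.log (2 * Fintype.card Ω / δ)⌉₊ → G |
            ε ≤ randomSchreierLambda Ω s} ≤ δ) := by
  constructor
  · intro ε hε
    -- Taking `t = ε` costs `ε / 2`; the logarithmic term is at most `ε / 2` once `2 log (2n) ≤ d
    -- ε²`, and `log (2n) ≤ 2 log n` for `n ≥ 2`.
    refine ⟨4 / ε ^ 2, by positivity, fun G Ω _ _ _ _ _ _ _ => ?_⟩
    have hn : (2 : ℝ) ≤ Fintype.card Ω := by exact_mod_cast Fintype.one_lt_card
    have hlog : 0 < Real.log (Fintype.card Ω) := Real.log_pos (by linarith)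
    have hd : 0 < ⌈4 / ε ^ 2 * Real.log (Fintype.card Ω)⌉₊ := Nat.ceil_pos.2 (by positivity)
    have hle := Nat.le_ceil (4 / ε ^ 2 * Real.log (Fintype.card Ω))
    have hd' : (0 : ℝ) < (⌈4 / ε ^ 2 * Real.log (Fintype.card Ω)⌉₊ : ℝ) := by exact_mod_cast hd
    refine (uniformExpectation_randomSchreierLambda_le hd hε).trans ?_
    generalize ((⌈4 / ε ^ 2 * Real.log (Fintype.card Ω)⌉₊ : ℕ) : ℝ) = d at *
    have h2 : Real.log (2 * Fintype.card Ω) ≤ 2 * Real.log (Fintype.card Ω) := by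
      rw [Real.log_mul two_ne_zero (by linarith), two_mul]
      gcongr
    have h3 : 4 * Real.log (Fintype.card Ω) ≤ d * ε ^ 2 := by
      rwa [div_mul_eq_mul_div, div_le_iff₀ (by positivity)] at hle
    have h4 : Real.log (2 * Fintype.card Ω) / (ε * d) ≤ ε / 2 := by
      rw [div_le_iff₀ (by positivity)]
      nlinarith
    linarith
  · intro G Ω _ _ _ _ _ _ _ ε δ hε hδ
    have hn : (0 : ℝ) < Fintype.card Ω := by exact_mod_cast Fintype.card_pos
    have hle := Nat.le_ceil (2 / ε ^ 2 * Real.log (2 * Fintype.card Ω / δ))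
    generalize ⌈2 / ε ^ 2 * Real.log (2 * Fintype.card Ω / δ)⌉₊ = d at *
    rcases Nat.eq_zero_or_pos d with rfl | hd
    · have : {s : Fin 0 → G | ε ≤ randomSchreierLambda Ω s} = ∅ := by
        ext s
        simp [randomSchreierLambda_of_isEmpty, hε]
      rw [this]
      simpa [uniformProbability] using hδ.le
    · refine (uniformProbability_le_randomSchreierLambda_le hd hε.le).trans ?_
      have h3 : Real.log (2 * Fintype.card Ω / δ) ≤ d * ε ^ 2 / 2 := by
        rw [div_mul_eq_mul_div, div_le_iff₀ (by positivity)] at hle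
        linarith
      rw [Real.log_le_iff_le_exp (by positivity), div_le_iff₀ hδ] at h3
      rw [Real.exp_neg, ← div_eq_mul_inv, div_le_iff₀ (Real.exp_pos _)]
      linarith
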